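/- For directed posets $P,Q$ write $P\le_T Q$ ($P$ is Tukey below $Q$) if there is a map $Q\to P$ sending cofinal subsets of $Q$ to cofinal subsets of $P$, and $P=_TQ$ if $P\le_TQ$ and $Q\le_TP$; $\mathrm{cof}(P)$ is the least cardinality of a cofinal subset of $P$. For cardinals $\tau,\kappa$, $[\tau]^{<\kappa}$ is the set of subsets of $\tau$ of cardinality less than $\kappa$, ordered by inclusion; $\omega^\omega$ and $([\tau]^{<\omega})^\omega$ are ordered coordinatewise; $\mathfrak d$ is the dominating number. Let $F(X)$ and $A(X)$ be the (Markov) free topological group and free Abelian topological group on $X$. For a topological group $G$ with identity $e$ let $\mathcal N_e(G)$ be the neighbourhood filter of $e$ ordered by reverse inclusion, and let $\chi(G)=\mathrm{cof}(\mathcal N_e(G))$ be its character. Let $X$ be an infinite compact Hausdorff space of weight $\tau$. Then 1. $\chi(F(X))=\chi(A(X))=\mathfrak d\cdot\mathrm{cof}([\tau]^{<\omega_1})=\mathrm{cof}\big(\omega^\omega\times[\tau]^{<\omega_1}\big)$; 2. $\omega^\omega\times[\tau]^{<\omega_1}\le_T([\tau]^{<\omega})^\omega$; 3. if $\tau$ is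 uncountable, then $([\tau]^{<\omega})^\omega\not\le_T\omega^\omega\times[\tau]^{<\omega_1}$, and $\mathcal N_e(F(X))\ne_T\omega^\omega\times[\tau]^{<\omega_1}$. -/

import Mathlib

open Cardinal Topology

universe u v w

/-! ### The Tukey order -/

/-- `P` is Tukey below `Q`: some map `Q → P` sends cofinal subsets to cofinal subsets. -/
def TukeyLE (P : Type v) (Q : Type w) [Preorder P] [Preorder Q] : Prop :=
  ∃ φ : Q → P, ∀ C : Set Q, IsCofinal C → IsCofinal (φ '' C)

/-- Tukey equivalence. -/
def TukeyEquiv (P : Type v) (Q : Type w) [Preorder P] [Preorder Q] : Prop :=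
  TukeyLE P Q ∧ TukeyLE Q P

/-! ### Cardinals and posets of small sets -/

/-- `[τ]^{<κ}`: the subsets of cardinality less than `κ` of a fixed set of cardinality `τ`,
ordered by inclusion. -/
abbrev SmallSubsets (τ κ : Cardinal.{u}) : Type u :=
  {A : Set τ.out // #A < κ}

/-- The dominating number: the least cardinality of a family of functions `ℕ → ℕ` that is cofinal
with respect to eventual domination. -/
noncomputable def dominatingNumber : Cardinal.{0} :=
  sInf {c | ∃ D : Set (ℕ → ℕ), (∀ f : ℕ → ℕ, ∃ g ∈ D, ∀ᶠ n in Filter.atTop, f n ≤ g n) ∧ #D = c}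

/-- The weight of a topological space: the least cardinality of a base of its topology. -/
noncomputable def topologicalWeight (X : Type u) [TopologicalSpace X] : Cardinal.{u} :=
  sInf {c | ∃ B : Set (Set X), TopologicalSpace.IsTopologicalBasis B ∧ #B = c}

/-! ### Neighbourhood filters and characters -/

/-- The neighbourhoods of `x`, ordered by reverse inclusion. -/
abbrev NhdsPoset {G : Type u} [TopologicalSpace G] (x : G) : Type u :=
  {U : Set G // U ∈ 𝓝 x}ᵒᵈ

/-- The character of a space at `x`: the least cardinality of a neighbourhood base at `x`. -/
noncomputable def characterAt {G : Type u} [TopologicalSpace G] (x : G) : Cardinal.{u} :=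
  Order.cof (NhdsPoset x)

/-! ### Free topological groups -/

/-- The (Markov) free topological group `F(X)`: the free group on `X`, with the finest group
topology for which the inclusion of `X` is continuous. -/
def FreeTopGroup (X : Type u) : Type u := FreeGroup X

namespace FreeTopGroup

variable (X : Type u)

instance : Group (FreeTopGroup X) := inferInstanceAs (Group (FreeGroup X))

/-- The inclusion of the generators. -/
def of {X : Type u} (x : X) : FreeTopGroup X := FreeGroup.of x

instance [TopologicalSpace X] : TopologicalSpace (FreeTopGroup X) :=
  (GroupTopology.coinduced (of : X → FreeTopGroup X)).toTopologicalSpace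

instance [TopologicalSpace X] : IsTopologicalGroup (FreeTopGroup X) :=
  (GroupTopology.coinduced (of : X → FreeTopGroup X)).toIsTopologicalGroup

/-- The universal property, with `continuous_of`. -/
theorem existsUnique_lift [TopologicalSpace X] {G : Type v} [Group G] [TopologicalSpace G]
    [IsTopologicalGroup G] (f : X → G) (hf : Continuous f) :
    ∃! φ : FreeTopGroup X →* G, Continuous φ ∧ ∀ x, φ (of x) = f x := by
  let φ : FreeTopGroup X →* G := FreeGroup.lift f
  have hφ : ∀ x, φ (of x) = f x := fun x => FreeGroup.lift_apply_of
  refine ⟨φ, ⟨?_, hφ⟩, fun ψ hψ => FreeGroup.ext_hom (M := G) ψ φ fun x =>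
    (hψ.2 x).trans (hφ x).symm⟩
  rw [continuous_iff_le_induced]
  let t : GroupTopology (FreeTopGroup X) :=
    ⟨TopologicalSpace.induced φ inferInstance, topologicalGroup_induced φ⟩
  have ht : GroupTopology.coinduced (of : X → FreeTopGroup X) ≤ t := by
    refine sInf_le ?_
    change TopologicalSpace.coinduced _ _ ≤ TopologicalSpace.induced φ _
    rw [← continuous_iff_coinduced_le, continuous_induced_rng]
    exact hf.congr fun x => (hφ x).symm
  exact ht

theorem continuous_of [TopologicalSpace X] : Continuous (of : X → FreeTopGroup X) :=
  GroupTopology.coinduced_continuous _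

end FreeTopGroup

/-- The (Markov) free Abelian topological group `A(X)`: the free Abelian group on `X`, with the
finest group topology for which the inclusion of `X` is continuous. -/
def FreeAbTopGroup (X : Type u) : Type u := FreeAbelianGroup X

namespace FreeAbTopGroup

variable (X : Type u)

instance : AddCommGroup (FreeAbTopGroup X) := inferInstanceAs (AddCommGroup (FreeAbelianGroup X))

/-- The inclusion of the generators. -/
def of {X : Type u} (x : X) : FreeAbTopGroup X := FreeAbelianGroup.of x

instance [TopologicalSpace X] : TopologicalSpace (FreeAbTopGroup X) :=
  (AddGroupTopology.coinduced (of : X → FreeAbTopGroup X)).toTopologicalSpace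

instance [TopologicalSpace X] : IsTopologicalAddGroup (FreeAbTopGroup X) :=
  (AddGroupTopology.coinduced (of : X → FreeAbTopGroup X)).toIsTopologicalAddGroup

/-- The universal property, with `continuous_of`. -/
theorem existsUnique_lift [TopologicalSpace X] {G : Type v} [AddCommGroup G] [TopologicalSpace G]
    [IsTopologicalAddGroup G] (f : X → G) (hf : Continuous f) :
    ∃! φ : FreeAbTopGroup X →+ G, Continuous φ ∧ ∀ x, φ (of x) = f x := by
  let φ : FreeAbTopGroup X →+ G := FreeAbelianGroup.lift f
  have hφ : ∀ x, φ (of x) = f x := fun x => FreeAbelianGroup.lift_apply_of f x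
  refine ⟨φ, ⟨?_, hφ⟩, fun ψ hψ => FreeAbelianGroup.lift_ext (g := ψ) (h := φ) fun x =>
    (hψ.2 x).trans (hφ x).symm⟩
  rw [continuous_iff_le_induced]
  let t : AddGroupTopology (FreeAbTopGroup X) :=
    ⟨TopologicalSpace.induced φ inferInstance, topologicalAddGroup_induced φ⟩
  have ht : AddGroupTopology.coinduced (of : X → FreeAbTopGroup X) ≤ t := by
    refine sInf_le ?_
    change TopologicalSpace.coinduced _ _ ≤ TopologicalSpace.induced φ _
    rw [← continuous_iff_coinduced_le, continuous_induced_rng]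
    exact hf.congr fun x => (hφ x).symm
  exact ht

theorem continuous_of [TopologicalSpace X] : Continuous (of : X → FreeAbTopGroup X) :=
  AddGroupTopology.coinduced_continuous _

end FreeAbTopGroup

/-! ### Tukey reductions -/

/-! Everything rests on one Tukey equivalence, `IsFreeTop.tukeyEquiv`: for both free groups the
neighbourhood filter of the identity is equivalent to `([τ]^{<ω})^ω`.

A neighbourhood of the identity is coded by neighbourhoods `U n` of the diagonal of `X`: `U n`
controls the quotients `x⁻¹y` that may be conjugated by words of length at most `n`, and `freeNhd`
multiplies such factors for distinct `n`. By compactness every diagonal neighbourhood contains a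
finite intersection of `τ` fixed ones, so sequences of finite subsets of `τ` suffice. Conversely,
`τ` many functions `f a : X → [0,1]`, pairwise at distance at least 1/4, extend to homomorphisms `φ
a` into `ℝ`. Sending `W` to the sets `{a | |φ a| ≤ k + 1 on W}` gives finite sets, because those `f
a` are equicontinuous, and the sequences so obtained are cofinal.

The rest is combinatorics. A sequence of finite sets is dominated by an enumerated countable set
together with a function in `ω^ω`, which gives the cofinality. Every uncountable family in `ω^ω ×
[τ]^{<ω₁}` has an infinite bounded subfamily, while no infinite family of constant singleton
sequences is bounded in `([τ]^{<ω})^ω`. -/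

theorem TukeyLE.of_monotone {P : Type v} {Q : Type w} [Preorder P] [Preorder Q] {φ : Q → P}
    (hφ : Monotone φ) (h : IsCofinal (Set.range φ)) : TukeyLE P Q := by
  refine ⟨φ, fun C hC p => ?_⟩
  obtain ⟨_, ⟨q, rfl⟩, hq⟩ := h p
  obtain ⟨c, hc, hqc⟩ := hC q
  exact ⟨φ c, ⟨c, hc, rfl⟩, hq.trans (hφ hqc)⟩

theorem TukeyLE.trans {P : Type*} {Q : Type*} {R : Type*} [Preorder P] [Preorder Q] [Preorder R]
    (h₁ : TukeyLE P Q) (h₂ : TukeyLE Q R) : TukeyLE P R := by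
  obtain ⟨φ, hφ⟩ := h₁
  obtain ⟨ψ, hψ⟩ := h₂
  refine ⟨φ ∘ ψ, fun C hC => ?_⟩
  rw [Set.image_comp]
  exact hφ _ (hψ _ hC)

theorem TukeyLE.cof_le {P Q : Type v} [Preorder P] [Preorder Q] (h : TukeyLE P Q) :
    Order.cof P ≤ Order.cof Q := by
  obtain ⟨φ, hφ⟩ := h
  obtain ⟨C, hC, hcard⟩ := Order.exists_cof_eq Q
  rw [← hcard]
  exact (Order.cof_le (hφ C hC)).trans mk_image_le

theorem TukeyEquiv.cof_eq {P Q : Type v} [Preorder P] [Preorder Q] (h : TukeyEquiv P Q) :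
    Order.cof P = Order.cof Q :=
  le_antisymm h.1.cof_le h.2.cof_le

/-- A Tukey reduction yields a map in the other direction sending unbounded sets to unbounded
sets. -/
theorem TukeyLE.exists_dual {P : Type v} {Q : Type w} [Preorder P] [Preorder Q]
    (h : TukeyLE P Q) : ∃ (φ : Q → P) (ψ : P → Q), ∀ p q, ψ p ≤ q → p ≤ φ q := by
  obtain ⟨φ, hφ⟩ := h
  suffices H : ∀ p, ∃ q, ∀ q', q ≤ q' → p ≤ φ q' by
    choose ψ hψ using H
    exact ⟨φ, ψ, hψ⟩
  intro p
  by_contra! hp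
  -- If `p` has no suitable `q`, this set is cofinal, yet no point of its image lies above `p`.
  have hC : IsCofinal {q | ¬ p ≤ φ q} := fun q => by
    obtain ⟨q', hq', hn⟩ := hp q
    exact ⟨q', hn, hq'⟩
  obtain ⟨_, ⟨q, hq, rfl⟩, hpq⟩ := hφ _ hC p
  exact hq hpq

/-! ### Cofinalities -/

theorem aleph0_le_dominatingNumber : ℵ₀ ≤ dominatingNumber := by
  have hne : {c | ∃ D : Set (ℕ → ℕ), (∀ f : ℕ → ℕ, ∃ g ∈ D, ∀ᶠ n in Filter.atTop, f n ≤ g n) ∧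
      #D = c}.Nonempty :=
    ⟨_, Set.univ, fun f => ⟨f, trivial, Filter.Eventually.of_forall fun _ => le_rfl⟩, rfl⟩
  obtain ⟨D, hD, hcard⟩ := csInf_mem hne
  rw [dominatingNumber, ← hcard]
  by_contra! hfin
  have hDf : D.Finite := lt_aleph0_iff_set_finite.1 hfin
  obtain ⟨g, hg, hev⟩ := hD fun n => (∑ g ∈ hDf.toFinset, g n) + 1
  obtain ⟨n, hn⟩ := hev.exists
  have := Finset.single_le_sum (f := fun g : ℕ → ℕ => g n) (fun _ _ => Nat.zero_le _)
    (hDf.mem_toFinset.2 hg)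
  exact absurd hn (by omega)

/-- The cofinality of `ℕ → ℕ` with the everywhere order is the dominating number. -/
theorem cof_nat_nat : Order.cof (ℕ → ℕ) = dominatingNumber := by
  apply le_antisymm
  · have hne : {c | ∃ D : Set (ℕ → ℕ), (∀ f : ℕ → ℕ, ∃ g ∈ D, ∀ᶠ n in Filter.atTop, f n ≤ g n) ∧
        #D = c}.Nonempty :=
      ⟨_, Set.univ, fun f => ⟨f, trivial, Filter.Eventually.of_forall fun _ => le_rfl⟩, rfl⟩
    have hinf := aleph0_le_dominatingNumber
    obtain ⟨D, hD, hcard⟩ := csInf_mem hne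
    rw [dominatingNumber, ← hcard] at hinf ⊢
    -- Raising `g` to a constant turns eventual into everywhere domination; the sum of the finitely
    -- many early values serves as the constant.
    have hC : IsCofinal (Set.range fun p : D × ℕ => fun n => max (p.1.1 n) p.2) := by
      intro f
      obtain ⟨g, hg, hev⟩ := hD f
      obtain ⟨N, hN⟩ := Filter.eventually_atTop.1 hev
      refine ⟨_, ⟨(⟨g, hg⟩, ∑ i ∈ Finset.range N, f i), rfl⟩, fun n => ?_⟩
      rcases le_or_gt N n with h | h
      · exact (hN n h).trans (le_max_left _ _)
      · exact (Finset.single_le_sum (f := f) (fun _ _ => Nat.zero_le _)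
          (Finset.mem_range.2 h)).trans (le_max_right _ _)
    refine (Order.cof_le hC).trans (mk_range_le.trans ?_)
    rw [mk_prod, lift_id, lift_id, mk_nat]
    exact (mul_le_mul_right hinf _).trans (mul_eq_self hinf).le
  · rw [Order.le_cof_iff]
    intro C hC
    refine csInf_le' ⟨C, fun f => ?_, rfl⟩
    obtain ⟨g, hg, hfg⟩ := hC f
    exact ⟨g, hg, Filter.Eventually.of_forall hfg⟩

/-- The cofinality of a product is the product of the cofinalities, if one of them is infinite. -/
theorem cof_prod {P : Type} {Q : Type u} [Preorder P] [Preorder Q] [Nonempty P] [Nonempty Q]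
    (hP : ℵ₀ ≤ Order.cof P) :
    Order.cof (P × Q) = lift.{u} (Order.cof P) * Order.cof Q := by
  apply le_antisymm
  · obtain ⟨C, hC, hc⟩ := Order.exists_cof_eq P
    obtain ⟨D, hD, hd⟩ := Order.exists_cof_eq Q
    have hCD : IsCofinal (C ×ˢ D) := fun p => by
      obtain ⟨c, hc, h1⟩ := hC p.1
      obtain ⟨d, hd, h2⟩ := hD p.2
      exact ⟨(c, d), ⟨hc, hd⟩, h1, h2⟩
    refine (Order.cof_le hCD).trans_eq ?_
    rw [← hc, ← hd, mk_congr (Equiv.Set.prod C D)]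
    simp
  · obtain ⟨C, hC, hc⟩ := Order.exists_cof_eq (P × Q)
    have h1 : lift.{u} (Order.cof P) ≤ #C := by
      have : IsCofinal (Prod.fst '' C) := fun p => by
        obtain ⟨c, hc, h⟩ := hC (p, Classical.arbitrary Q)
        exact ⟨c.1, ⟨c, hc, rfl⟩, h.1⟩
      have h := lift_le.{u}.2 (Order.cof_le this)
      exact h.trans (by simpa using mk_image_le_lift (f := Prod.fst) (s := C))
    have h2 : Order.cof Q ≤ #C := by
      have : IsCofinal (Prod.snd '' C) := fun q => by
        obtain ⟨c, hc, h⟩ := hC (Classical.arbitrary P, q)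
        exact ⟨c.2, ⟨c, hc, rfl⟩, h.2⟩
      exact (Order.cof_le this).trans mk_image_le
    rw [← hc]
    have hinf : ℵ₀ ≤ #C := le_trans (by simpa using hP) h1
    exact (mul_le_mul' h1 h2).trans (mul_eq_self hinf).le

instance SmallSubsets.nonempty_aleph1 (τ : Cardinal.{u}) : Nonempty (SmallSubsets τ ℵ₁) :=
  ⟨⟨∅, by simp⟩⟩

theorem lt_aleph1_iff_countable {α : Type u} (A : Set α) : #A < ℵ₁ ↔ A.Countable := by
  rw [lt_aleph_one_iff, ← le_aleph0_iff_set_countable]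

theorem cof_prod_smallSubsets (τ : Cardinal.{u}) :
    Order.cof ((ℕ → ℕ) × SmallSubsets τ ℵ₁) =
      lift.{u} dominatingNumber * Order.cof (SmallSubsets τ ℵ₁) := by
  rw [cof_prod (by rw [cof_nat_nat]; exact aleph0_le_dominatingNumber), cof_nat_nat]

/-- `s ↦ (n ↦ |s n|, ⋃ n, s n)` witnesses `ω^ω × [τ]^{<ω₁} ≤_T ([τ]^{<ω})^ω`. -/
theorem tukeyLE_prod_seq {τ : Cardinal.{u}} (hτ : ℵ₀ ≤ τ) :
    TukeyLE ((ℕ → ℕ) × SmallSubsets τ ℵ₁) (ℕ → SmallSubsets τ ℵ₀) := by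
  have hfin : ∀ (s : ℕ → SmallSubsets τ ℵ₀) n, (s n).1.Finite :=
    fun s n => lt_aleph0_iff_set_finite.1 (s n).2
  have : Infinite τ.out := by rwa [infinite_iff, mk_out]
  refine TukeyLE.of_monotone (φ := fun s => (fun n => (s n).1.ncard, ⟨⋃ n, (s n).1,
    (lt_aleph1_iff_countable _).2 (Set.countable_iUnion fun n => (hfin s n).countable)⟩)) ?_ ?_
  · exact fun s t hst => ⟨fun n => Set.ncard_le_ncard (hst n) (hfin t n),
      Set.iUnion_mono fun n => hst n⟩
  · rintro ⟨f, A, hA⟩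
    obtain ⟨e, he⟩ : ∃ e : ℕ → τ.out, A ⊆ Set.range e := by
      rcases A.eq_empty_or_nonempty with rfl | hne
      · exact ⟨fun _ => Classical.arbitrary _, Set.empty_subset _⟩
      · obtain ⟨e, he⟩ := ((lt_aleph1_iff_countable A).1 hA).exists_eq_range hne
        exact ⟨e, he.le⟩
    -- `F n` supplies the required size `f n`; adding the point `e n` makes the union cover `A`.
    choose F _ hF using fun n => Set.infinite_univ (α := τ.out) |>.exists_subset_card_eq (f n)
    classical
    refine ⟨_, ⟨fun n => ⟨↑(insert (e n) (F n)), lt_aleph0_iff_set_finite.2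
      (Finset.finite_toSet _)⟩, rfl⟩, fun n => ?_, fun a ha => ?_⟩
    · simp only [Set.ncard_coe_finset]
      rw [← hF n]
      exact Finset.card_le_card (Finset.subset_insert _ _)
    · obtain ⟨n, rfl⟩ := he ha
      exact Set.mem_iUnion.2 ⟨n, by simp⟩

/-- A sequence of finite sets has countable union, hence lies in some enumerated `A` from a cofinal
family; each term then sits in an initial segment of the enumeration, and the lengths of the
segments form a function in `ω^ω`. -/
theorem cof_seq_smallSubsets {τ : Cardinal.{u}} (hτ : ℵ₀ ≤ τ) :
    Order.cof (ℕ → SmallSubsets τ ℵ₀) =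
      lift.{u} dominatingNumber * Order.cof (SmallSubsets τ ℵ₁) := by
  apply le_antisymm
  · have : Infinite τ.out := by rwa [infinite_iff, mk_out]
    have hen : ∀ A : SmallSubsets τ ℵ₁, ∃ e : ℕ → τ.out, A.1 ⊆ Set.range e := by
      intro A
      rcases A.1.eq_empty_or_nonempty with h | hne
      · exact ⟨fun _ => Classical.arbitrary _, h ▸ Set.empty_subset _⟩
      · obtain ⟨e, he⟩ := ((lt_aleph1_iff_countable A.1).1 A.2).exists_eq_range hne
        exact ⟨e, he.le⟩
    choose e he using hen
    obtain ⟨C, hC, hc⟩ := Order.exists_cof_eq (ℕ → ℕ)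
    obtain ⟨D, hD, hd⟩ := Order.exists_cof_eq (SmallSubsets τ ℵ₁)
    let Φ : C × D → ℕ → SmallSubsets τ ℵ₀ := fun p n =>
      ⟨e p.2.1 '' Set.Iic (p.1.1 n),
        lt_aleph0_iff_set_finite.2 ((Set.finite_Iic _).image _)⟩
    have hΦ : IsCofinal (Set.range Φ) := by
      intro s
      have hfin : ∀ n, (s n).1.Finite := fun n => lt_aleph0_iff_set_finite.1 (s n).2
      obtain ⟨A, hA, hsA⟩ := hD ⟨⋃ n, (s n).1, (lt_aleph1_iff_countable _).2
        (Set.countable_iUnion fun n => (hfin n).countable)⟩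
      have hb : ∀ n, ∃ N, (s n).1 ⊆ e A '' Set.Iic N := by
        intro n
        have hsub : ∀ a ∈ (s n).1, ∃ i, e A i = a := fun a ha => he A (hsA (Set.mem_iUnion.2 ⟨n, ha⟩))
        choose! i hi using hsub
        obtain ⟨N, hN⟩ := ((hfin n).image i).bddAbove
        exact ⟨N, fun a ha => ⟨i a, hN ⟨a, ha, rfl⟩, hi a ha⟩⟩
      choose N hN using hb
      obtain ⟨f, hf, hNf⟩ := hC N
      exact ⟨_, ⟨(⟨f, hf⟩, ⟨A, hA⟩), rfl⟩, fun n => (hN n).trans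
        (Set.image_mono (Set.Iic_subset_Iic.2 (hNf n)))⟩
    refine (Order.cof_le hΦ).trans (mk_range_le.trans_eq ?_)
    rw [← cof_nat_nat, ← hc, ← hd]
    simp
  · rw [← cof_prod_smallSubsets]
    exact (tukeyLE_prod_seq hτ).cof_le

/-- An uncountable family in `ℕ → ℕ` has an infinite bounded subfamily. -/
theorem exists_injective_bddAbove {I : Type u} (hI : ℵ₀ < #I) (g : I → ℕ → ℕ) :
    ∃ b : ℕ → I, Function.Injective b ∧ ∃ h : ℕ → ℕ, ∀ j, g (b j) ≤ h := by
  -- Some `g a` has infinitely many indices in each of its basic neighbourhoods; otherwise the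
  -- countably many cylinders would split `I` into countably many finite pieces.
  obtain ⟨a, ha⟩ : ∃ a, ∀ n, {b | ∀ i < n, g b i = g a i}.Infinite := by
    by_contra! H
    choose n hn using H
    have hn' : ∀ a, {b | ∀ i < n a, g b i = g a i}.Finite := fun a => by simpa using hn a
    let F : I → Σ n, Fin n → ℕ := fun a => ⟨n a, fun i => g a i⟩
    have hcount : (⋃ σ, F ⁻¹' {σ}).Countable := by
      refine Set.countable_iUnion fun σ => ?_
      rcases (F ⁻¹' {σ}).eq_empty_or_nonempty with h | ⟨a, rfl⟩
      · simp [h]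
      · refine ((hn' a).subset fun b hb => ?_).countable
        intro i hi
        have hb' : F b = F a := hb
        have h2 : ∀ σ : Σ n, Fin n → ℕ, F b = σ → ∀ i (h : i < σ.1), g b i = σ.2 ⟨i, h⟩ := by
          rintro _ rfl i h
          rfl
        exact h2 _ hb' i hi
    have huniv : (⋃ σ, F ⁻¹' {σ}) = Set.univ := by
      ext a
      simp
    rw [huniv, ← le_aleph0_iff_set_countable, mk_univ] at hcount
    exact hcount.not_gt hI
  -- Distinct indices agreeing with `g a` on ever longer initial segments: at each coordinate only
  -- finitely many of them can deviate.
  obtain ⟨f, hf, hfr⟩ := exists_seq_of_forall_finset_exists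
    (fun p : ℕ × I => ∀ i < p.1, g p.2 i = g a i) (fun p q => p.1 < q.1 ∧ p.2 ≠ q.2)
    (fun s _ => by
      classical
      obtain ⟨b, hb, hbs⟩ := (ha (s.sup Prod.fst + 1)).exists_notMem_finset (s.image Prod.snd)
      refine ⟨(s.sup Prod.fst + 1, b), hb, fun x hx => ⟨?_, ?_⟩⟩
      · exact Nat.lt_succ_of_le (Finset.le_sup (f := Prod.fst) hx)
      · rintro rfl
        exact hbs (Finset.mem_image_of_mem _ hx))
  have hmono : StrictMono fun n => (f n).1 := fun m n hmn => (hfr m n hmn).1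
  refine ⟨fun j => (f j).2, fun m n hmn => ?_,
    fun i => g a i + ∑ j ∈ Finset.range (i + 1), g (f j).2 i, fun j i => ?_⟩
  · rcases lt_trichotomy m n with h | h | h
    · exact absurd hmn (hfr m n h).2
    · exact h
    · exact absurd hmn.symm (hfr n m h).2
  · rcases le_or_gt j i with h | h
    · exact (Finset.single_le_sum (f := fun j => g (f j).2 i) (fun _ _ => Nat.zero_le _)
        (Finset.mem_range.2 (Nat.lt_succ_of_le h))).trans (Nat.le_add_left _ _)
    · rw [hf j i (h.trans_le (hmono.id_le j))]
      exact Nat.le_add_right _ _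

/-- For uncountable `τ`, `([τ]^{<ω})^ω` is not Tukey below `ω^ω × [τ]^{<ω₁}`: in the latter, but
not in the former, every uncountable set has an infinite bounded subset. -/
theorem not_tukeyLE_seq_prod {τ : Cardinal.{u}} (hτ : ℵ₀ < τ) :
    ¬ TukeyLE (ℕ → SmallSubsets τ ℵ₀) ((ℕ → ℕ) × SmallSubsets τ ℵ₁) := by
  intro h
  obtain ⟨φ, ψ, H⟩ := h.exists_dual
  -- A common bound for infinitely many of these constant sequences would need an infinite set as
  -- its zeroth term.
  let p : τ.out → ℕ → SmallSubsets τ ℵ₀ := fun a _ =>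
    ⟨{a}, lt_aleph0_iff_set_finite.2 (Set.finite_singleton a)⟩
  obtain ⟨b, hb, h, hbound⟩ := exists_injective_bddAbove (by rwa [mk_out])
    fun a => (ψ (p a)).1
  let q : (ℕ → ℕ) × SmallSubsets τ ℵ₁ := (h, ⟨⋃ j, (ψ (p (b j))).2.1,
    (lt_aleph1_iff_countable _).2 (Set.countable_iUnion fun j =>
      (lt_aleph1_iff_countable _).1 (ψ (p (b j))).2.2)⟩)
  have hq : ∀ j, b j ∈ (φ q 0).1 := fun j =>
    H (p (b j)) q ⟨hbound j, Set.subset_iUnion (fun j => (ψ (p (b j))).2.1) j⟩ 0 rfl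
  exact (Set.infinite_range_of_injective hb)
    ((lt_aleph0_iff_set_finite.1 (φ q 0).2).subset (Set.range_subset_iff.2 hq))

/-! ### Compact Hausdorff spaces -/

section Weight

variable (X : Type u) [TopologicalSpace X]

theorem exists_basis_card_eq_weight :
    ∃ B : Set (Set X), TopologicalSpace.IsTopologicalBasis B ∧ #B = topologicalWeight X :=
  csInf_mem (s := {c | ∃ B : Set (Set X), TopologicalSpace.IsTopologicalBasis B ∧ #B = c})
    ⟨_, _, TopologicalSpace.isTopologicalBasis_opens, rfl⟩

variable {X} in
theorem topologicalWeight_le {B : Set (Set X)} (hB : TopologicalSpace.IsTopologicalBasis B) :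
    topologicalWeight X ≤ #B :=
  csInf_le' ⟨B, hB, rfl⟩

theorem aleph0_le_topologicalWeight [T2Space X] [Infinite X] : ℵ₀ ≤ topologicalWeight X := by
  obtain ⟨B, hB, hcard⟩ := exists_basis_card_eq_weight X
  rw [← hcard]
  by_contra! hfin
  have hBf : Finite B := lt_aleph0_iff_finite.1 hfin
  have hinj : Function.Injective fun x : X => {b : B | x ∈ b.1} := by
    intro x y hxy
    by_contra hne
    obtain ⟨u, v, hu, -, hxu, hyv, huv⟩ := t2_separation hne
    obtain ⟨b, hb, hxb, hbu⟩ := hB.exists_subset_of_mem_open hxu hu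
    have hyb : y ∈ b := (Set.ext_iff.1 hxy ⟨b, hb⟩).1 hxb
    exact Set.disjoint_left.1 huv (hbu hyb) hyv
  exact not_finite_iff_infinite.2 ‹Infinite X› (Finite.of_injective _ hinj)

variable {X} in
/-- The neighbourhoods of the diagonal of a compact Hausdorff space of weight `τ` are generated by
`τ` many of them. -/
theorem exists_diagonal_subbase [CompactSpace X] [T2Space X] [Infinite X] {τ : Cardinal.{u}}
    (hτ : topologicalWeight X = τ) :
    ∃ E : τ.out → Set (X × X), (∀ a x, E a ∈ 𝓝 (x, x)) ∧
      ∀ U : Set (X × X), (∀ x, U ∈ 𝓝 (x, x)) → ∃ F : Finset τ.out, (⋂ a ∈ F, E a) ⊆ U := by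
  classical
  obtain ⟨B, hB, hcard⟩ := exists_basis_card_eq_weight X
  have hinf := aleph0_le_topologicalWeight X
  rw [hτ] at hcard hinf
  obtain ⟨e⟩ : Nonempty (τ.out ≃ B × B) := by
    rw [← Cardinal.eq, mk_out, ← mul_def, hcard, mul_eq_self hinf]
  -- The closure condition is what makes `E b` a diagonal neighbourhood: each `x` is in `b.2` or off
  -- the closure of `b.1`. The pair `(x, y)` is excluded by choosing `b.1` around `x` and `b.2` away
  -- from `y`.
  let E : B × B → Set (X × X) := fun b => {p | closure b.1.1 ⊆ b.2.1 → p.1 ∈ b.1.1 → p.2 ∈ b.2.1}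
  have hE : ∀ b x, E b ∈ 𝓝 (x, x) := by
    intro b x
    by_cases hb : closure b.1.1 ⊆ b.2.1
    · by_cases hx : x ∈ b.2.1
      · filter_upwards [continuous_snd.continuousAt.preimage_mem_nhds
          ((hB.isOpen b.2.2).mem_nhds hx : b.2.1 ∈ 𝓝 (x, x).2)] with p hp _ _ using hp
      · have hx' : x ∈ (closure b.1.1)ᶜ := fun h => hx (hb h)
        filter_upwards [continuous_fst.continuousAt.preimage_mem_nhds
          (isClosed_closure.isOpen_compl.mem_nhds hx' : (closure b.1.1)ᶜ ∈ 𝓝 (x, x).1)]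
          with p hp _ hp' using absurd (subset_closure hp') hp
    · exact Filter.mem_of_superset Filter.univ_mem fun p _ h => absurd h hb
  refine ⟨fun a => E (e a), fun a x => hE _ x, fun U hU => ?_⟩
  have hK : IsCompact (interior U)ᶜ := isOpen_interior.isClosed_compl.isCompact
  obtain ⟨F, hF⟩ : ∃ F : Finset τ.out, Disjoint (interior U)ᶜ (⋂ a ∈ F, E (e a)) := by
    refine hK.induction_on (p := fun s => ∃ F : Finset τ.out, Disjoint s (⋂ a ∈ F, E (e a)))
      ⟨∅, Set.empty_disjoint _⟩ ?_ ?_ ?_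
    · rintro s t hst ⟨F, hF⟩
      exact ⟨F, hF.mono_left hst⟩
    · rintro s t ⟨F, hF⟩ ⟨F', hF'⟩
      refine ⟨F ∪ F', Set.disjoint_union_left.2 ⟨hF.mono_right ?_, hF'.mono_right ?_⟩⟩
      · exact Set.biInter_subset_biInter_left fun a ha => Finset.mem_union_left _ ha
      · exact Set.biInter_subset_biInter_left fun a ha => Finset.mem_union_right _ ha
    · rintro ⟨x, y⟩ hxy
      have hne : x ≠ y := by
        rintro rfl
        exact hxy (mem_interior_iff_mem_nhds.2 (hU x))
      obtain ⟨u, v, hu, hv, hxu, hyv, huv⟩ := t2_separation hne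
      obtain ⟨b₂, hb₂, hxb₂, hbu⟩ := hB.exists_subset_of_mem_open hxu hu
      obtain ⟨b₁, hb₁, hxb₁, hb₁₂⟩ := hB.exists_closure_subset ((hB.isOpen hb₂).mem_nhds hxb₂)
      refine ⟨b₁ ×ˢ v, mem_nhdsWithin_of_mem_nhds (prod_mem_nhds ((hB.isOpen hb₁).mem_nhds hxb₁)
        (hv.mem_nhds hyv)), {e.symm (⟨b₁, hb₁⟩, ⟨b₂, hb₂⟩)}, ?_⟩
      rw [Set.disjoint_left]
      rintro ⟨z, w⟩ ⟨hz, hw⟩ hzw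
      simp only [Finset.mem_singleton, Set.iInter_iInter_eq_left, Equiv.apply_symm_apply] at hzw
      exact Set.disjoint_left.1 huv (hbu (hzw hb₁₂ hz)) hw
  exact ⟨F, fun p hp => interior_subset (not_not.1 fun h => Set.disjoint_left.1 hF h hp)⟩

variable {X} in
/-- An infinite family of real functions separating points bounds the weight. -/
theorem topologicalWeight_le_of_separating [CompactSpace X] {S : Set C(X, ℝ)}
    (hS : S.Infinite) (hsep : ∀ x y, x ≠ y → ∃ s ∈ S, s x ≠ s y) :
    topologicalWeight X ≤ #S := by
  -- By compactness this injection is an embedding, so preimages of a countable base of `ℝ` form a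
  -- subbase of `X`.
  let ev : X → S → ℝ := fun x s => s.1 x
  have hcont : Continuous ev := continuous_pi fun s => s.1.continuous
  have hinj : Function.Injective ev := fun x y hxy => by
    by_contra hne
    obtain ⟨s, hs, h⟩ := hsep x y hne
    exact h (congrFun hxy ⟨s, hs⟩)
  have hind := (hcont.isClosedEmbedding hinj).isInducing
  let O := TopologicalSpace.countableBasis ℝ
  let sub : S × O → Set X := fun p => p.1.1 ⁻¹' p.2.1
  have hgen : ‹TopologicalSpace X› = TopologicalSpace.generateFrom (Set.range sub) := by
    have hO : (inferInstance : TopologicalSpace ℝ) = TopologicalSpace.generateFrom O :=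
      (TopologicalSpace.isBasis_countableBasis ℝ).eq_generateFrom
    refine hind.eq_induced.trans ?_
    rw [Pi.topologicalSpace, induced_iInf]
    have : Set.range sub = ⋃ s : S, Set.preimage s.1 '' O := by
      ext A
      simp [sub, Set.mem_iUnion]
    rw [this, generateFrom_iUnion]
    refine iInf_congr fun s => ?_
    rw [← induced_generateFrom_eq, ← hO, induced_compose]
    rfl
  have hSinf : ℵ₀ ≤ #S := infinite_iff.1 hS.to_subtype
  refine (topologicalWeight_le (TopologicalSpace.isTopologicalBasis_of_subbasis hgen)).trans ?_
  have hSO : #(S × O) ≤ #S := by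
    have hO : lift.{u} #O ≤ ℵ₀ := lift_le_aleph0.2
      (le_aleph0_iff_set_countable.2 (TopologicalSpace.countable_countableBasis ℝ))
    rw [mk_prod, lift_uzero]
    exact (mul_le_mul_right (hO.trans hSinf) _).trans (mul_eq_self hSinf).le
  have : Infinite S := hS.to_subtype
  have : Infinite (S × O) := by
    obtain ⟨o, ho, -⟩ := (TopologicalSpace.isBasis_countableBasis ℝ).exists_subset_of_mem_open
      (Set.mem_univ (0 : ℝ)) isOpen_univ
    have : Nonempty O := ⟨⟨o, ho⟩⟩
    infer_instance
  have hsub : (fun f => ⋂₀ f) '' {f : Set (Set X) | f.Finite ∧ f ⊆ Set.range sub} ⊆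
      Set.range fun F : Finset (S × O) => ⋂ p ∈ F, sub p := by
    classical
    rintro _ ⟨f, ⟨hf, hfs⟩, rfl⟩
    choose! g hg using hfs
    refine ⟨hf.toFinset.image g, ?_⟩
    ext x
    simp only [Set.mem_iInter, Finset.mem_image, Set.Finite.mem_toFinset, Set.mem_sInter]
    constructor
    · intro h A hA
      rw [← hg hA]
      exact h _ ⟨A, hA, rfl⟩
    · rintro h _ ⟨A, hA, rfl⟩
      rw [hg hA]
      exact h A hA
  refine (mk_le_mk_of_subset hsub).trans (mk_range_le.trans ?_)
  rwa [mk_finset_of_infinite]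

theorem natFloor_eq_imp_abs_sub_lt {n : ℕ} {a b : ℝ} (ha : 0 ≤ a) (hb : 0 ≤ b)
    (h : ⌊n * a⌋₊ = ⌊n * b⌋₊) : n * |a - b| < 1 := by
  have h1 := Nat.floor_le (by positivity : 0 ≤ n * a)
  have h2 := Nat.lt_floor_add_one (n * a)
  have h3 := Nat.floor_le (by positivity : 0 ≤ n * b)
  have h4 := Nat.lt_floor_add_one (n * b)
  rw [h] at h1 h2
  rw [← Nat.abs_cast n, ← abs_mul, abs_lt, mul_sub]
  constructor <;> linarith

theorem natFloor_mul_lt {n : ℕ} {a : ℝ} (ha : a ∈ Set.Icc (0 : ℝ) 1) : ⌊n * a⌋₊ < n + 1 :=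
  Nat.lt_succ_of_le (Nat.floor_le_of_le (mul_le_of_le_one_right n.cast_nonneg ha.2))

variable {X} in
/-- There are `τ` many uniformly separated continuous functions into the unit interval. -/
theorem exists_separated_family [CompactSpace X] [T2Space X] [Infinite X] {τ : Cardinal.{u}}
    (hτ : topologicalWeight X = τ) :
    ∃ f : τ.out → C(X, ℝ), (∀ a x, f a x ∈ Set.Icc (0 : ℝ) 1) ∧
      ∀ a b, a ≠ b → ∃ x, 1 / 4 ≤ |f a x - f b x| := by
  obtain ⟨S, hS⟩ := zorn_subset {S : Set C(X, ℝ) | (∀ f ∈ S, ∀ x, f x ∈ Set.Icc (0 : ℝ) 1) ∧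
      S.Pairwise fun f g => ∃ x, 1 / 4 ≤ |f x - g x|} (by
    intro c hc hchain
    refine ⟨⋃₀ c, ⟨?_, ?_⟩, fun s hs => Set.subset_sUnion_of_mem hs⟩
    · rintro f ⟨s, hs, hf⟩
      exact (hc hs).1 f hf
    · exact (Set.pairwise_sUnion hchain.directedOn).2 fun s hs => (hc hs).2)
  -- A Urysohn function with values 0 at `x` and 1 at `y` cannot be within 1/4 of an `s` that varies
  -- by at most 1/2 between them. By maximality it would belong to `S`, where it separates the
  -- points itself.
  have hsep : ∀ x y, x ≠ y → ∃ s ∈ S, 1 / 2 < |s x - s y| := by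
    intro x y hxy
    by_contra! hcon
    obtain ⟨f, hf0, hf1, hf⟩ := exists_continuous_zero_one_of_isClosed
      (isClosed_singleton (x := x)) (isClosed_singleton (x := y)) (by simpa using hxy)
    have hfx : f x = 0 := hf0 rfl
    have hfy : f y = 1 := hf1 rfl
    have hdist : ∀ s ∈ S, ∃ z, 1 / 4 ≤ |f z - s z| := by
      intro s hs
      by_contra! hlt
      have h1 := abs_lt.1 (hlt x)
      have h2 := abs_lt.1 (hlt y)
      have h3 := abs_le.1 (hcon s hs)
      rw [hfx] at h1
      rw [hfy] at h2
      linarith [h1.1, h2.2, h3.1]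
    have hmem : f ∈ S := hS.mem_of_prop_insert ⟨by
      rintro g (rfl | hg)
      · exact hf
      · exact hS.prop.1 g hg, hS.prop.2.insert fun s hs _ => ⟨hdist s hs, by
          simpa only [abs_sub_comm] using hdist s hs⟩⟩
    have := hcon f hmem
    rw [hfx, hfy] at this
    norm_num at this
  have hinf : S.Infinite := by
    intro hfin
    have : Finite S := hfin
    obtain ⟨x, y, hxy, h⟩ := Finite.exists_ne_map_eq_of_infinite
      fun (x : X) (s : S) => (⟨⌊(4 : ℕ) * s.1 x⌋₊, natFloor_mul_lt (hS.prop.1 s s.2 x)⟩ : Fin (4 + 1))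
    obtain ⟨s, hs, hlt⟩ := hsep x y hxy
    have := natFloor_eq_imp_abs_sub_lt (hS.prop.1 s hs x).1 (hS.prop.1 s hs y).1
      (congrArg Fin.val (congrFun h ⟨s, hs⟩))
    push_cast at this
    linarith
  have hle : #τ.out ≤ #S := by
    rw [mk_out, ← hτ]
    refine topologicalWeight_le_of_separating hinf fun x y hxy => ?_
    obtain ⟨s, hs, h⟩ := hsep x y hxy
    refine ⟨s, hs, fun he => ?_⟩
    norm_num [he] at h
  obtain ⟨i⟩ := hle
  exact ⟨fun a => (i a).1, fun a x => hS.prop.1 _ (i a).2 x, fun a b hab =>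
    hS.prop.2 (i a).2 (i b).2 fun h => hab (i.injective (Subtype.ext h))⟩

end Weight

/-! ### Neighbourhoods of the identity in a free topological group -/

section FreeNhds

open Pointwise

variable {X : Type u} {G : Type v} [Group G]

/-- `ι : X → G` generates `G`, the topology of `G` is the finest group topology making `ι`
continuous, and all real functions on `X` extend to homomorphisms. Both the free and the free
Abelian topological group are of this kind. -/
structure IsFreeTop [TopologicalSpace X] [TopologicalSpace G] (ι : X → G) : Prop where
  continuous : Continuous ι
  closure_range : Subgroup.closure (Set.range ι) = ⊤
  le_of_continuous : ∀ t : GroupTopology G,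
    @Continuous _ _ _ t.toTopologicalSpace ι → ‹TopologicalSpace G› ≤ t.toTopologicalSpace
  -- Only algebra is asked of `φ`; continuity will enter through `f` and `ι`.
  exists_lift : ∀ f : X → ℝ, ∃ φ : G → ℝ, (∀ g h, φ (g * h) = φ g + φ h) ∧ ∀ x, φ (ι x) = f x

/-- The elements expressible by words of length at most `n`. -/
def wordBall (ι : X → G) (n : ℕ) : Set G := (Set.range ι ∪ (Set.range ι)⁻¹ ∪ {1}) ^ n

theorem wordBall_mul_mem {ι : X → G} {m n : ℕ} {g h : G} (hg : g ∈ wordBall ι m)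
    (hh : h ∈ wordBall ι n) : g * h ∈ wordBall ι (m + n) := by
  rw [wordBall, pow_add]
  exact Set.mul_mem_mul hg hh

theorem wordBall_mono (ι : X → G) : Monotone (wordBall ι) := fun _ _ h =>
  Set.pow_subset_pow_right (Or.inr rfl) h

theorem one_mem_wordBall (ι : X → G) (n : ℕ) : (1 : G) ∈ wordBall ι n :=
  wordBall_mono ι n.zero_le (by simp [wordBall])

theorem exists_mem_wordBall {ι : X → G} (h : Subgroup.closure (Set.range ι) = ⊤) (g : G) :
    ∃ n, g ∈ wordBall ι n := by
  have hg : g ∈ Subgroup.closure (Set.range ι) := h ▸ Subgroup.mem_top g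
  induction hg using Subgroup.closure_induction'' with
  | mem x hx => exact ⟨1, by rw [wordBall, pow_one]; exact Or.inl (Or.inl hx)⟩
  | inv_mem x hx => exact ⟨1, by
      rw [wordBall, pow_one]; exact Or.inl (Or.inr (Set.inv_mem_inv.2 hx))⟩
  | one => exact ⟨0, one_mem_wordBall ι 0⟩
  | mul x y _ _ hx hy =>
    obtain ⟨m, hm⟩ := hx
    obtain ⟨n, hn⟩ := hy
    exact ⟨m + n, wordBall_mul_mem hm hn⟩

theorem isCompact_wordBall [TopologicalSpace X] [CompactSpace X] [TopologicalSpace G]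
    [IsTopologicalGroup G] {ι : X → G} (hι : Continuous ι) (n : ℕ) : IsCompact (wordBall ι n) := by
  have h : IsCompact (Set.range ι ∪ (Set.range ι)⁻¹ ∪ {1}) :=
    ((isCompact_range hι).union (isCompact_range hι).inv).union isCompact_singleton
  induction n with
  | zero => simp [wordBall]
  | succ n ih =>
    rw [wordBall, pow_succ]
    exact ih.mul h

/-- The conjugates by words of length at most `n` of the quotients `x⁻¹y` of pairs in `U`. -/
def conjQuot (ι : X → G) (U : Set (X × X)) (n : ℕ) : Set G :=
  {a | ∃ g ∈ wordBall ι n, ∃ p ∈ U,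
    a = g * ((ι p.1)⁻¹ * ι p.2) * g⁻¹ ∨ a = g * ((ι p.2)⁻¹ * ι p.1) * g⁻¹}

theorem conjQuot_mono {ι : X → G} {U V : Set (X × X)} (h : U ⊆ V) {m n : ℕ} (hmn : m ≤ n) :
    conjQuot ι U m ⊆ conjQuot ι V n := by
  rintro a ⟨g, hg, p, hp, ha⟩
  exact ⟨g, wordBall_mono ι hmn hg, p, h hp, ha⟩

theorem inv_mem_conjQuot {ι : X → G} {U : Set (X × X)} {n : ℕ} {a : G}
    (ha : a ∈ conjQuot ι U n) : a⁻¹ ∈ conjQuot ι U n := by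
  obtain ⟨g, hg, p, hp, rfl | rfl⟩ := ha
  · exact ⟨g, hg, p, hp, Or.inr (by group)⟩
  · exact ⟨g, hg, p, hp, Or.inl (by group)⟩

theorem conj_mem_conjQuot {ι : X → G} {U : Set (X × X)} {m n : ℕ} {a h : G}
    (hh : h ∈ wordBall ι m) (ha : a ∈ conjQuot ι U n) :
    h * a * h⁻¹ ∈ conjQuot ι U (m + n) := by
  obtain ⟨g, hg, p, hp, rfl | rfl⟩ := ha
  · exact ⟨h * g, wordBall_mul_mem hh hg, p, hp, Or.inl (by group)⟩
  · exact ⟨h * g, wordBall_mul_mem hh hg, p, hp, Or.inr (by group)⟩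

/-- The products, in any order, of elements of `conjQuot ι (U n) n` for distinct `n`. -/
def freeNhd (ι : X → G) (U : ℕ → Set (X × X)) : Set G :=
  {g | ∃ l : List (ℕ × G), (l.map Prod.fst).Nodup ∧ (∀ p ∈ l, p.2 ∈ conjQuot ι (U p.1) p.1) ∧
    (l.map Prod.snd).prod = g}

theorem freeNhd_mono {ι : X → G} {U V : ℕ → Set (X × X)} (h : ∀ n, U n ⊆ V n) :
    freeNhd ι U ⊆ freeNhd ι V := by
  rintro g ⟨l, hl, hmem, hg⟩
  exact ⟨l, hl, fun p hp => conjQuot_mono (h _) le_rfl (hmem p hp), hg⟩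

theorem one_mem_freeNhd (ι : X → G) (U : ℕ → Set (X × X)) : (1 : G) ∈ freeNhd ι U :=
  ⟨[], by simp⟩

/-- Sending the indices of the two factors to even and odd numbers keeps them distinct; they only
grow, so the conjugators remain admissible. -/
theorem freeNhd_mul_subset (ι : X → G) (U : ℕ → Set (X × X)) :
    freeNhd ι (fun n => U (2 * n) ∩ U (2 * n + 1)) *
      freeNhd ι (fun n => U (2 * n) ∩ U (2 * n + 1)) ⊆ freeNhd ι U := by
  rintro _ ⟨_, ⟨l₁, hl₁, h₁, rfl⟩, _, ⟨l₂, hl₂, h₂, rfl⟩, rfl⟩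
  refine ⟨l₁.map (Prod.map (2 * ·) id) ++ l₂.map (Prod.map (2 * · + 1) id), ?_, ?_, ?_⟩
  · rw [List.map_append, List.map_map, List.map_map, Prod.map_fst', Prod.map_fst',
      ← List.map_map, ← List.map_map]
    refine List.Nodup.append (hl₁.map fun a b h => by simpa using h)
      (hl₂.map fun a b h => by simpa using h) ?_
    intro a ha hb
    obtain ⟨i, -, rfl⟩ := List.mem_map.1 ha
    obtain ⟨j, -, hj⟩ := List.mem_map.1 hb
    omega
  · intro p hp
    rcases List.mem_append.1 hp with hp | hp
    · obtain ⟨q, hq, rfl⟩ := List.mem_map.1 hp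
      exact conjQuot_mono Set.inter_subset_left (by simp; omega) (h₁ q hq)
    · obtain ⟨q, hq, rfl⟩ := List.mem_map.1 hp
      exact conjQuot_mono Set.inter_subset_right (by simp; omega) (h₂ q hq)
  · simp [List.map_map, Prod.map_snd']

theorem inv_mem_freeNhd {ι : X → G} {U : ℕ → Set (X × X)} {g : G} (hg : g ∈ freeNhd ι U) :
    g⁻¹ ∈ freeNhd ι U := by
  obtain ⟨l, hl, h, rfl⟩ := hg
  refine ⟨(l.map (Prod.map id (·⁻¹))).reverse, ?_, ?_, ?_⟩
  · rw [List.map_reverse, List.nodup_reverse, List.map_map]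
    exact hl
  · intro p hp
    obtain ⟨q, hq, rfl⟩ := List.mem_map.1 (List.mem_reverse.1 hp)
    exact inv_mem_conjQuot (h q hq)
  · rw [List.prod_inv_reverse, List.map_reverse, List.map_map, List.map_map]
    rfl

/-- Shifting every index by `m` makes room for a conjugator of length `m`. -/
theorem conj_mem_freeNhd {ι : X → G} {U : ℕ → Set (X × X)} {m : ℕ} {g h : G}
    (hh : h ∈ wordBall ι m) (hg : g ∈ freeNhd ι fun n => U (m + n)) :
    h * g * h⁻¹ ∈ freeNhd ι U := by
  obtain ⟨l, hl, hmem, rfl⟩ := hg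
  refine ⟨l.map (Prod.map (m + ·) (h * · * h⁻¹)), ?_, ?_, ?_⟩
  · rw [List.map_map, Prod.map_fst', ← List.map_map]
    exact hl.map fun a b h => by simpa using h
  · intro p hp
    obtain ⟨q, hq, rfl⟩ := List.mem_map.1 hp
    exact conj_mem_conjQuot hh (hmem q hq)
  · rw [List.map_map, Prod.map_snd', ← List.map_map]
    exact (map_list_prod (MulAut.conj h) (l.map Prod.snd)).symm

/-- A product, in any order, of elements of distinct members of a sequence of sets whose triple
products shrink. -/
theorem list_prod_mem_of_mul_subset {W : ℕ → Set G} (h1 : ∀ n, (1 : G) ∈ W n)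
    (h3 : ∀ n, ∀ a ∈ W (n + 1), ∀ b ∈ W (n + 1), ∀ c ∈ W (n + 1), a * b * c ∈ W n)
    (l : List (ℕ × G)) (m : ℕ) (hl : (l.map Prod.fst).Nodup)
    (hmem : ∀ p ∈ l, m ≤ p.1 ∧ p.2 ∈ W (p.1 + 1)) : (l.map Prod.snd).prod ∈ W m := by
  have hanti : Antitone W := antitone_nat_of_succ_le fun n a ha => by
    simpa using h3 n a ha 1 (h1 _) 1 (h1 _)
  induction hlen : l.length using Nat.strong_induction_on generalizing l m with
  | _ k ih =>
    rcases eq_or_ne l [] with rfl | hne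
    · simpa using h1 m
    -- Split at the factor of least index `p.1`: by induction both sides lie in `W (p.1 + 1)`, as
    -- does the factor, so the triple product lies in `W p.1`.
    · obtain ⟨p, hp, hmin⟩ : ∃ p ∈ l, ∀ q ∈ l, p.1 ≤ q.1 := by
        classical
        obtain ⟨p, hp, hmin⟩ := l.toFinset.exists_min_image Prod.fst
          ((List.toFinset_nonempty_iff l).2 hne)
        exact ⟨p, List.mem_toFinset.1 hp, fun q hq => hmin q (List.mem_toFinset.2 hq)⟩
      obtain ⟨s, t, rfl⟩ := List.append_of_mem hp
      have hnd : (s.map Prod.fst).Nodup ∧ (t.map Prod.fst).Nodup ∧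
          (∀ q ∈ s, q.1 ≠ p.1) ∧ ∀ q ∈ t, q.1 ≠ p.1 := by
        simp only [List.map_append, List.map_cons, List.nodup_append, List.nodup_cons,
          List.mem_map, List.mem_cons] at hl
        refine ⟨hl.1, hl.2.1.2, fun q hq => hl.2.2 _ ⟨q, hq, rfl⟩ _ (Or.inl rfl), fun q hq h => ?_⟩
        exact hl.2.1.1 ⟨q, hq, h⟩
      have hlt : ∀ q ∈ s ++ t, q.1 ≠ p.1 → p.1 + 1 ≤ q.1 ∧ q.2 ∈ W (q.1 + 1) := by
        intro q hq hne
        have hq' : q ∈ s ++ p :: t := by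
          simp only [List.mem_append, List.mem_cons] at hq ⊢
          tauto
        exact ⟨(hmin q hq').lt_of_ne' hne, (hmem q hq').2⟩
      have hs := ih s.length (by simp [← hlen]) s (p.1 + 1) hnd.1
        (fun q hq => hlt q (List.mem_append_left _ hq) (hnd.2.2.1 q hq)) rfl
      have ht := ih t.length (by simp [← hlen]; omega) t (p.1 + 1) hnd.2.1
        (fun q hq => hlt q (List.mem_append_right _ hq) (hnd.2.2.2 q hq)) rfl
      have := h3 p.1 _ hs _ (hmem p hp).2 _ ht
      simp only [List.map_append, List.map_cons, List.prod_append, List.prod_cons, ← mul_assoc]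
      exact hanti (hmem p hp).1 this

variable [TopologicalSpace X]

/-- The sets `freeNhd ι U` form a neighbourhood base of the identity of a group topology. -/
abbrev freeNhdBasis {ι : X → G} (hι : Subgroup.closure (Set.range ι) = ⊤) : GroupFilterBasis G where
  sets := {N | ∃ U : ℕ → Set (X × X), (∀ n x, U n ∈ 𝓝 (x, x)) ∧ freeNhd ι U = N}
  nonempty := ⟨_, fun _ => Set.univ, fun _ _ => Filter.univ_mem, rfl⟩
  inter_sets := by
    rintro _ _ ⟨U, hU, rfl⟩ ⟨V, hV, rfl⟩
    exact ⟨_, ⟨fun n => U n ∩ V n, fun n x => Filter.inter_mem (hU n x) (hV n x), rfl⟩,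
      Set.subset_inter (freeNhd_mono fun _ => Set.inter_subset_left)
        (freeNhd_mono fun _ => Set.inter_subset_right)⟩
  one' := by
    rintro _ ⟨U, -, rfl⟩
    exact one_mem_freeNhd ι U
  mul' := by
    rintro _ ⟨U, hU, rfl⟩
    exact ⟨_, ⟨_, fun n x => Filter.inter_mem (hU _ x) (hU _ x), rfl⟩, freeNhd_mul_subset ι U⟩
  inv' := by
    rintro _ ⟨U, hU, rfl⟩
    exact ⟨_, ⟨U, hU, rfl⟩, fun g hg => inv_mem_freeNhd hg⟩
  conj' := by
    rintro h _ ⟨U, hU, rfl⟩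
    obtain ⟨m, hm⟩ := exists_mem_wordBall hι h
    exact ⟨_, ⟨_, fun n x => hU (m + n) x, rfl⟩, fun g hg => conj_mem_freeNhd hm hg⟩

variable [TopologicalSpace G]

/-- The sets `freeNhd ι U` define a group topology in which `ι` is continuous, since `x⁻¹y` is a
single factor of index 0; the given topology is finer. -/
theorem IsFreeTop.freeNhd_mem_nhds {ι : X → G} (hι : IsFreeTop ι) {U : ℕ → Set (X × X)}
    (hU : ∀ n x, U n ∈ 𝓝 (x, x)) : freeNhd ι U ∈ 𝓝 (1 : G) := by
  let B := freeNhdBasis hι.closure_range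
  let t : GroupTopology G := ⟨B.topology, B.isTopologicalGroup⟩
  have hcont : @Continuous _ _ _ t.toTopologicalSpace ι := by
    let := B.topology
    change Continuous ι
    rw [continuous_iff_continuousAt]
    intro x
    rw [ContinuousAt, (B.nhds_hasBasis (ι x)).tendsto_right_iff]
    rintro _ ⟨V, hV, rfl⟩
    have hx : ∀ᶠ y in 𝓝 x, (x, y) ∈ V 0 :=
      (Continuous.prodMk_right x).continuousAt.preimage_mem_nhds (hV 0 x)
    filter_upwards [hx] with y hy
    refine ⟨(ι x)⁻¹ * ι y, ⟨[(0, (ι x)⁻¹ * ι y)], by simp, ?_, by simp⟩, by simp⟩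
    intro p hp
    rw [List.mem_singleton] at hp
    subst hp
    exact ⟨1, one_mem_wordBall ι 0, (x, y), hy, Or.inl (by simp)⟩
  exact nhds_mono (hι.le_of_continuous t hcont) (B.mem_nhds_one ⟨U, hU, rfl⟩)

theorem exists_freeNhd_subset [CompactSpace X] [IsTopologicalGroup G] {ι : X → G}
    (hι : Continuous ι) {W : Set G} (hW : W ∈ 𝓝 (1 : G)) :
    ∃ U : ℕ → Set (X × X), (∀ n x, U n ∈ 𝓝 (x, x)) ∧ freeNhd ι U ⊆ W := by
  have hstep : ∀ V : {V : Set G // V ∈ 𝓝 (1 : G)}, ∃ V' : {V : Set G // V ∈ 𝓝 (1 : G)},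
      ∀ a ∈ V'.1, ∀ b ∈ V'.1, ∀ c ∈ V'.1, a * b * c ∈ V.1 := by
    rintro ⟨V, hV⟩
    obtain ⟨V₁, hV₁, h₁⟩ := exists_nhds_one_split hV
    obtain ⟨V₂, hV₂, h₂⟩ := exists_nhds_one_split hV₁
    refine ⟨⟨V₂ ∩ V₁, Filter.inter_mem hV₂ hV₁⟩, fun a ha b hb c hc => ?_⟩
    exact h₁ _ (h₂ a ha.1 b hb.1) _ hc.2
  choose next hnext using hstep
  let S : ℕ → {V : Set G // V ∈ 𝓝 (1 : G)} := fun n => next^[n] ⟨W, hW⟩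
  have hS : ∀ n, S (n + 1) = next (S n) := fun n => Function.iterate_succ_apply' _ _ _
  -- Compactness of the word ball makes one neighbourhood work for all conjugators of length at most
  -- `n`. The target `S (n + 1)` is the one required by `list_prod_mem_of_mul_subset`.
  have hT : ∀ n, {t : G | ∀ g ∈ wordBall ι n, g * t * g⁻¹ ∈ (S (n + 1)).1} ∈ 𝓝 (1 : G) := by
    intro n
    refine (isCompact_wordBall hι n).eventually_forall_of_forall_eventually
      (P := fun t g => g * t * g⁻¹ ∈ (S (n + 1)).1) fun g _ => ?_
    have hc : ContinuousAt (fun z : G × G => z.2 * z.1 * z.2⁻¹) (1, g) := by fun_prop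
    exact hc.preimage_mem_nhds (by simpa using (S (n + 1)).2)
  refine ⟨fun n => {p | (ι p.1)⁻¹ * ι p.2 ∈ {t | ∀ g ∈ wordBall ι n, g * t * g⁻¹ ∈ (S (n + 1)).1} ∧
    (ι p.2)⁻¹ * ι p.1 ∈ {t | ∀ g ∈ wordBall ι n, g * t * g⁻¹ ∈ (S (n + 1)).1}}, ?_, ?_⟩
  · intro n x
    have hc₁ : Continuous fun p : X × X => (ι p.1)⁻¹ * ι p.2 := by fun_prop
    have hc₂ : Continuous fun p : X × X => (ι p.2)⁻¹ * ι p.1 := by fun_prop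
    exact Filter.inter_mem
      ((hc₁.tendsto' (x, x) 1 (by simp)).eventually_mem (hT n))
      ((hc₂.tendsto' (x, x) 1 (by simp)).eventually_mem (hT n))
  · rintro _ ⟨l, hl, hmem, rfl⟩
    refine list_prod_mem_of_mul_subset (W := fun n => (S n).1) (fun n => mem_of_mem_nhds (S n).2)
      (fun n => by rw [hS]; exact hnext _) l 0 hl fun p hp => ⟨p.1.zero_le, ?_⟩
    obtain ⟨g, hg, q, hq, h | h⟩ := hmem p hp
    · rw [h]
      exact hq.1 g hg
    · rw [h]
      exact hq.2 g hg

end FreeNhds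

/-! ### The Tukey type of the neighbourhood filter -/

section FreeTukey

variable {X : Type u} [TopologicalSpace X] [CompactSpace X] [T2Space X] [Infinite X]
  {G : Type v} [Group G] [TopologicalSpace G] [IsTopologicalGroup G] {ι : X → G}
  {τ : Cardinal.{u}}

theorem IsFreeTop.nhds_tukeyLE_seq (hι : IsFreeTop ι) (hτ : topologicalWeight X = τ) :
    TukeyLE (NhdsPoset (1 : G)) (ℕ → SmallSubsets τ ℵ₀) := by
  obtain ⟨E, hE, hEU⟩ := exists_diagonal_subbase hτ
  refine TukeyLE.of_monotone (φ := fun s => OrderDual.toDual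
    ⟨freeNhd ι fun n => ⋂ a ∈ (s n).1, E a, hι.freeNhd_mem_nhds fun n x =>
      (Filter.biInter_mem (lt_aleph0_iff_set_finite.1 (s n).2)).2 fun a _ => hE a x⟩) ?_ ?_
  · intro s t hst
    exact freeNhd_mono fun n => Set.biInter_subset_biInter_left (hst n)
  · rintro ⟨W, hW⟩
    obtain ⟨U, hU, hUW⟩ := exists_freeNhd_subset hι.continuous hW
    choose F hF using fun n => hEU (U n) (hU n)
    exact ⟨_, ⟨fun n => ⟨F n, lt_aleph0_iff_set_finite.2 (F n).finite_toSet⟩, rfl⟩,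
      (freeNhd_mono hF).trans hUW⟩

/-- Source of the bound `k + 1`: at most `k` indices lie below `k`, and the geometric terms add up
to at most 1. -/
theorem sum_add_geometric_le (S : Finset ℕ) (k : ℕ) :
    ∑ i ∈ S, ((if i < k then 1 else 0) + 1 / 2 / 2 ^ i : ℝ) ≤ k + 1 := by
  rw [Finset.sum_add_distrib]
  refine add_le_add ?_ (sum_le_hasSum S (fun i _ => by positivity) (hasSum_geometric_two' 1))
  rw [Finset.sum_boole]
  have : S.filter (· < k) ⊆ Finset.range k := fun i hi => by
    simpa using (Finset.mem_filter.1 hi).2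
  exact_mod_cast (Finset.card_le_card this).trans_eq (Finset.card_range k)

theorem IsFreeTop.seq_tukeyLE_nhds (hι : IsFreeTop ι) (hτ : topologicalWeight X = τ) :
    TukeyLE (ℕ → SmallSubsets τ ℵ₀) (NhdsPoset (1 : G)) := by
  obtain ⟨f, hf, hsep⟩ := exists_separated_family hτ
  choose φ hmul hφ using fun a => hι.exists_lift (f a)
  have hone : ∀ a, φ a 1 = 0 := fun a => by simpa using hmul a 1 1
  have hinv : ∀ a g, φ a g⁻¹ = -φ a g := fun a g => by
    have := hmul a g g⁻¹
    rw [mul_inv_cancel, hone] at this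
    linarith
  have hpow : ∀ a g (n : ℕ), φ a (g ^ n) = n * φ a g := fun a g n => by
    induction n with
    | zero => simp [hone]
    | succ n ih =>
      rw [pow_succ, hmul, ih]
      push_cast
      ring
  have hlist : ∀ a (l : List G), |φ a l.prod| ≤ (l.map fun g => |φ a g|).sum := fun a l => by
    induction l with
    | nil => simp [hone]
    | cons g l ih =>
      rw [List.prod_cons, hmul, List.map_cons, List.sum_cons]
      exact (abs_add_le _ _).trans (by linarith)
  have hquot : ∀ a x y, φ a ((ι x)⁻¹ * ι y) = f a y - f a x := fun a x y => by
    rw [hmul, hinv, hφ, hφ]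
    ring
  have hfin : ∀ W ∈ 𝓝 (1 : G), ∀ k : ℕ, {a | ∀ g ∈ W, |φ a g| ≤ k + 1}.Finite := by
    intro W hW k
    -- If the power of `x⁻¹y` lies in `W`, then `|φ a| ≤ k + 1` on `W` forces `f a` to vary by at
    -- most 1/16 from `x` to `y`. With values at the finitely many centres rounded to 1/16,
    -- functions in one class differ by at most 3/16 < 1/4.
    have hV : {g : G | g ^ (16 * (k + 1)) ∈ W} ∈ 𝓝 (1 : G) :=
      ((continuous_pow (16 * (k + 1))).tendsto' (1 : G) 1 (one_pow _)).eventually_mem hW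
    obtain ⟨T, -, hT⟩ := isCompact_univ.elim_nhds_subcover
      (fun x : X => {y | (ι x)⁻¹ * ι y ∈ {g : G | g ^ (16 * (k + 1)) ∈ W}}) (fun x _ => by
        have hc : Continuous fun y => (ι x)⁻¹ * ι y := continuous_const.mul hι.continuous
        exact (hc.tendsto' x 1 (by simp)).eventually_mem hV)
    have hsmall : ∀ a ∈ {a | ∀ g ∈ W, |φ a g| ≤ k + 1}, ∀ x y,
        ((ι x)⁻¹ * ι y) ^ (16 * (k + 1)) ∈ W → |f a y - f a x| ≤ 1 / 16 := by
      intro a ha x y hxy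
      have h := ha _ hxy
      rw [hpow, hquot, abs_mul, Nat.abs_cast] at h
      push_cast at h
      have hk : (0 : ℝ) < k + 1 := by positivity
      have : (k + 1 : ℝ) * (16 * |f a y - f a x|) ≤ (k + 1) * 1 := by linarith
      linarith [le_of_mul_le_mul_left this hk]
    refine Set.Finite.of_injOn (f := fun a (x : T) =>
      (⟨⌊(16 : ℕ) * f a x⌋₊, natFloor_mul_lt (hf a x)⟩ : Fin (16 + 1)))
      (Set.mapsTo_univ _ _) ?_ Set.finite_univ
    intro a ha b hb hab
    by_contra hne
    obtain ⟨y, hy⟩ := hsep a b hne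
    obtain ⟨x, hxT, hx⟩ := Set.mem_iUnion₂.1 (hT (Set.mem_univ y))
    have h1 := abs_le.1 (hsmall a ha x y hx)
    have h2 := abs_le.1 (hsmall b hb x y hx)
    have h3 := natFloor_eq_imp_abs_sub_lt (hf a x).1 (hf b x).1
      (congrArg Fin.val (congrFun hab ⟨x, hxT⟩))
    push_cast at h3
    have h4 : |f a x - f b x| ≤ 1 / 16 := by linarith
    have h5 := abs_le.1 h4
    have : |f a y - f b y| ≤ 3 / 16 := abs_le.2 ⟨by linarith [h1.1, h2.2, h5.1],
      by linarith [h1.2, h2.1, h5.2]⟩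
    linarith
  refine TukeyLE.of_monotone (φ := fun W k => ⟨{a | ∀ g ∈ (OrderDual.ofDual W).1, |φ a g| ≤ k + 1},
    lt_aleph0_iff_set_finite.2 (hfin _ (OrderDual.ofDual W).2 k)⟩) ?_ ?_
  · intro V W hVW k a ha g hg
    exact ha g (hVW hg)
  · intro s
    -- Ranging over all `j ≤ i` controls each `a ∈ s k` at every index `i ≥ k`; a factor of smaller
    -- index costs at most 1, as `f a` has values in the unit interval. Conjugators vanish under `φ
    -- a`.
    let U : ℕ → Set (X × X) := fun i =>
      {p | ∀ j ∈ Set.Iic i, ∀ a ∈ (s j).1, |f a p.2 - f a p.1| ≤ 1 / 2 / 2 ^ i}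
    have hU : ∀ i x, U i ∈ 𝓝 (x, x) := by
      intro i x
      refine (Filter.eventually_all_finite (Set.finite_Iic i)).2 fun j _ =>
        (Filter.eventually_all_finite (lt_aleph0_iff_set_finite.1 (s j).2)).2 fun a _ => ?_
      have hc : Continuous fun p : X × X => |f a p.2 - f a p.1| := by fun_prop
      exact (hc.tendsto' (x, x) 0 (by simp)).eventually_le_const (by positivity)
    refine ⟨_, ⟨OrderDual.toDual ⟨freeNhd ι U, hι.freeNhd_mem_nhds hU⟩, rfl⟩, fun k a ha => ?_⟩
    rintro _ ⟨l, hl, hmem, rfl⟩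
    have hterm : ∀ p ∈ l, |φ a p.2| ≤ (if p.1 < k then 1 else 0) + 1 / 2 / 2 ^ p.1 := by
      intro p hp
      obtain ⟨g, -, q, hq, h⟩ := hmem p hp
      have habs : |φ a p.2| = |f a q.2 - f a q.1| := by
        rcases h with h | h
        · rw [h, hmul, hmul, hinv, hquot]
          congr 1
          ring
        · rw [h, hmul, hmul, hinv, hquot, abs_sub_comm]
          congr 1
          ring
      rw [habs]
      split_ifs with hk
      · have h1 := hf a q.1
        have h2 := hf a q.2
        have : (0 : ℝ) ≤ 1 / 2 / 2 ^ p.1 := by positivity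
        have : |f a q.2 - f a q.1| ≤ 1 := abs_le.2 ⟨by linarith [h1.2, h2.1],
          by linarith [h1.1, h2.2]⟩
        linarith
      · rw [zero_add]
        exact hq k (not_lt.1 hk) a ha
    refine (hlist a _).trans ?_
    rw [List.map_map]
    refine (List.sum_le_sum (g := fun p : ℕ × G =>
      ((if p.1 < k then 1 else 0) + 1 / 2 / 2 ^ p.1 : ℝ)) hterm).trans ?_
    have := sum_add_geometric_le (l.map Prod.fst).toFinset k
    rw [List.sum_toFinset _ hl, List.map_map] at this
    exact this

theorem IsFreeTop.tukeyEquiv (hι : IsFreeTop ι) (hτ : topologicalWeight X = τ) :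
    TukeyEquiv (NhdsPoset (1 : G)) (ℕ → SmallSubsets τ ℵ₀) :=
  ⟨hι.nhds_tukeyLE_seq hτ, hι.seq_tukeyLE_nhds hτ⟩

end FreeTukey

/-! ### The free groups and the main theorem -/

theorem FreeTopGroup.isFreeTop (X : Type u) [TopologicalSpace X] :
    IsFreeTop (FreeTopGroup.of : X → FreeTopGroup X) where
  continuous := FreeTopGroup.continuous_of X
  closure_range := FreeGroup.closure_range_of X
  le_of_continuous t ht := by
    have : GroupTopology.coinduced (of : X → FreeTopGroup X) ≤ t :=
      sInf_le (continuous_iff_coinduced_le.1 ht)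
    exact this
  exists_lift f := by
    let φ : FreeGroup X →* Multiplicative ℝ := FreeGroup.lift fun x => Multiplicative.ofAdd (f x)
    exact ⟨fun g => Multiplicative.toAdd (φ g), fun g h => congrArg _ (map_mul φ g h),
      fun x => congrArg Multiplicative.toAdd FreeGroup.lift_apply_of⟩

/-- The additive group topology corresponding to a topology on `Multiplicative A`. -/
def GroupTopology.ofMultiplicative {A : Type u} [AddGroup A]
    (t : GroupTopology (Multiplicative A)) : AddGroupTopology A :=
  let _ : TopologicalSpace A := t.toTopologicalSpace
  { toTopologicalSpace := t.toTopologicalSpace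
    toIsTopologicalAddGroup :=
      { continuous_add := t.toIsTopologicalGroup.continuous_mul
        continuous_neg := t.toIsTopologicalGroup.continuous_inv } }

/-- The free Abelian topological group, written multiplicatively. -/
theorem FreeAbTopGroup.isFreeTop (X : Type u) [TopologicalSpace X] :
    IsFreeTop fun x : X => Multiplicative.ofAdd (FreeAbTopGroup.of x) where
  continuous := continuous_ofAdd.comp (FreeAbTopGroup.continuous_of X)
  closure_range := by
    rw [eq_top_iff]
    rintro g -
    induction g using Multiplicative.rec with
    | ofAdd g =>
    refine FreeAbelianGroup.induction_on (motive := fun g : FreeAbTopGroup X =>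
      Multiplicative.ofAdd g ∈ Subgroup.closure _) g (one_mem _) ?_ ?_ ?_
    · exact fun x => Subgroup.subset_closure ⟨x, rfl⟩
    · exact fun x hx => inv_mem hx
    · exact fun x y hx hy => mul_mem hx hy
  le_of_continuous t ht := by
    have : AddGroupTopology.coinduced (of : X → FreeAbTopGroup X) ≤ t.ofMultiplicative :=
      sInf_le (continuous_iff_coinduced_le.1 ht)
    exact this
  exists_lift f := by
    let φ : FreeAbelianGroup X →+ ℝ := FreeAbelianGroup.lift f
    exact ⟨fun g => φ (Multiplicative.toAdd g), fun g h => map_add φ _ _,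
      fun x => FreeAbelianGroup.lift_apply_of f x⟩

theorem mainTheorem11 (X : Type u) [TopologicalSpace X] [CompactSpace X] [T2Space X] [Infinite X]
    (τ : Cardinal.{u}) (hτ : topologicalWeight X = τ) :
    -- the characters agree
    (characterAt (1 : FreeTopGroup X) =
        lift.{u} dominatingNumber * Order.cof (SmallSubsets τ ℵ₁) ∧
      characterAt (0 : FreeAbTopGroup X) =
        lift.{u} dominatingNumber * Order.cof (SmallSubsets τ ℵ₁) ∧
      Order.cof ((ℕ → ℕ) × SmallSubsets τ ℵ₁) =
        lift.{u} dominatingNumber * Order.cof (SmallSubsets τ ℵ₁)) ∧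
    -- one Tukey reduction always holds
    TukeyLE ((ℕ → ℕ) × SmallSubsets τ ℵ₁) (ℕ → SmallSubsets τ ℵ₀) ∧
    -- the other fails when the weight is uncountable, hence so does Tukey equivalence
    (ℵ₀ < τ →
      ¬ TukeyLE (ℕ → SmallSubsets τ ℵ₀) ((ℕ → ℕ) × SmallSubsets τ ℵ₁) ∧
      ¬ TukeyEquiv (NhdsPoset (1 : FreeTopGroup X)) ((ℕ → ℕ) × SmallSubsets τ ℵ₁)) := by
  have hinf : ℵ₀ ≤ τ := hτ ▸ aleph0_le_topologicalWeight X
  have hF := (FreeTopGroup.isFreeTop X).tukeyEquiv hτ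
  -- The multiplicative copy of `A(X)` has the same neighbourhoods by definition.
  have hA : TukeyEquiv (NhdsPoset (0 : FreeAbTopGroup X)) (ℕ → SmallSubsets τ ℵ₀) :=
    (FreeAbTopGroup.isFreeTop X).tukeyEquiv hτ
  refine ⟨⟨hF.cof_eq.trans (cof_seq_smallSubsets hinf), hA.cof_eq.trans (cof_seq_smallSubsets hinf),
    cof_prod_smallSubsets τ⟩, tukeyLE_prod_seq hinf, fun h => ⟨not_tukeyLE_seq_prod h, fun he =>
      not_tukeyLE_seq_prod h (hF.2.trans he.1)⟩⟩
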